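/- A snake with $N$ edges in the $n$-dimensional hypercube $\{0,1\}^n$ is a sequence of vertices $p_0,\dots,p_N$ such that consecutive vertices differ in exactly one bit, and for $k>j+1$ the vertices $p_j$ and $p_k$ are neither equal nor adjacent. Its snake game is the $n$-player game with action set $\{0,1\}$ for each player in which every player receives the same utility $u(a)=k+1$ if $a=p_k$ for some $k$, and $u(a)=0$ if the joint action $a$ is not on the path. A run of fictitious play is a sequence $x^{(1)},x^{(2)},\dots$ of joint mixed strategies such that for all $t\ge 1$ and every player $i$, $x_i^{(t+1)}$ is a pure strategy that maximizes $\langle x_i,\sum_{\tau=1}^{t}u_i^{(\tau)}\rangle$ over $x_i$ in the simplex of player $i$, where $u_i^{(\tau)}[a]=u_i(a,x_{-i}^{(\tau)})$ is the expected utility of action $a$ against the strategies of the others in iteration $\tau$. Ties are broken arbitrarily. A joint mixed strategy is an $\epsilon$-Nash equilibrium if no player can gain more than $\epsilon$ in expected utility by a unilateral deviation. **Theorem.** There is an absolute constant $C>0$ such that for every $n\ge 1$ there is a snake $p_0,\dots,p_N$ in the $n$-dimensional hypercube with $N\ge C\cdot 2^n$ whose snake game, an $n$-player binary-action identical-interest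 (hence potential) game, has the following properties. 1. For every $0\le\epsilon<1$ (in particular for exact Nash equilibria, $\epsilon=0$) and every run of fictitious play with $x^{(1)}=p_0$, if $x^{(t)}$ is an $\epsilon$-Nash equilibrium, then $t\ge \lfloor C\cdot 2^n\rfloor!$. 2. If $n\ge 2$, divide all payoffs by $N+1$; the result is an identical-interest (hence potential) game with payoffs in $[0,1]$. For every $0\le\epsilon\le 1/2^n$ and every run of fictitious play in it with $x^{(1)}=p_0$, if $x^{(t)}$ is an $\epsilon$-Nash equilibrium, then $t\ge 2^{C\cdot 2^n}$. -/

import Mathlib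

namespace FP

section Games

variable {ι : Type*} [Fintype ι] [DecidableEq ι] {A : ι → Type*} [∀ i, Fintype (A i)]

/-- The expected value of `f` under the product of the mixed strategies `x i`. -/
noncomputable def expectedUtility (f : (∀ i, A i) → ℝ) (x : ∀ i, A i → ℝ) : ℝ :=
  ∑ a : ∀ i, A i, (∏ i, x i (a i)) * f a

/-- `x` is a joint mixed strategy: each player has a probability distribution on her actions. -/
def IsMixedProfile (x : ∀ i, A i → ℝ) : Prop :=
  ∀ i, x i ∈ stdSimplex ℝ (A i)

/-- The joint mixed strategy `x` is an `ε`-Nash equilibrium of the normal-form game in which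
player `i` has utility `u i`. -/
def IsEpsNash (u : ι → (∀ i, A i) → ℝ) (ε : ℝ) (x : ∀ i, A i → ℝ) : Prop :=
  IsMixedProfile x ∧
    ∀ i, ∀ y ∈ stdSimplex ℝ (A i),
      expectedUtility (u i) (Function.update x i y) ≤ expectedUtility (u i) x + ε

/-- All players have the same utility function. -/
def IsIdenticalInterest (u : ι → (∀ i, A i) → ℝ) : Prop :=
  ∀ i j, u i = u j

/-- Exact potential games: a single function of the joint mixed strategy records the change of
utility under every unilateral deviation. -/
def IsPotentialGame (u : ι → (∀ i, A i) → ℝ) : Prop :=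
  ∃ Φ : (∀ i, A i → ℝ) → ℝ,
    ∀ x : ∀ i, A i → ℝ, IsMixedProfile x →
      ∀ i, ∀ y ∈ stdSimplex ℝ (A i), ∀ y' ∈ stdSimplex ℝ (A i),
        expectedUtility (u i) (Function.update x i y) -
            expectedUtility (u i) (Function.update x i y') =
          Φ (Function.update x i y) - Φ (Function.update x i y')

variable [∀ i, DecidableEq (A i)]

/-- The joint mixed strategy in which player `i` plays the action `a i` with probability one. -/
def pureProfile (a : ∀ i, A i) : ∀ i, A i → ℝ :=
  fun i => Pi.single (a i) 1

/-- The utility vector that player `i` observes when the joint strategy is `x`: the entry at `b` is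
the expected utility of playing `b` against the strategies of the other players. -/
noncomputable def utilityVector (u : ι → (∀ i, A i) → ℝ) (i : ι) (x : ∀ i, A i → ℝ) : A i → ℝ :=
  fun b => expectedUtility (u i) (Function.update x i (Pi.single b 1))

/-- The sum of the utility vectors that player `i` observes in iterations `1, …, t`. -/
noncomputable def cumulativeUtility (u : ι → (∀ i, A i) → ℝ) (x : ℕ → ∀ i, A i → ℝ) (i : ι)
    (t : ℕ) : A i → ℝ :=
  ∑ τ ∈ Finset.Icc 1 t, utilityVector u i (x τ)

/-- `x 1, x 2, …` is a run of (simultaneous) fictitious play, under some tie-breaking: in each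
iteration after the first, each player plays a pure strategy that maximizes the cumulative utility
over her simplex. The value `x 0` plays no role. -/
structure IsFictitiousPlay (u : ι → (∀ i, A i) → ℝ) (x : ℕ → ∀ i, A i → ℝ) : Prop where
  mixed_one : IsMixedProfile (x 1)
  pure_succ : ∀ t, 1 ≤ t → ∀ i, ∃ b : A i, x (t + 1) i = Pi.single b 1
  argmax : ∀ t, 1 ≤ t → ∀ i, ∀ y ∈ stdSimplex ℝ (A i),
    y ⬝ᵥ cumulativeUtility u x i t ≤ x (t + 1) i ⬝ᵥ cumulativeUtility u x i t

end Games

section Snakes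

variable {n N : ℕ}

/-- `p 0, …, p N` is a snake (in the box) with `N` edges in the `n`-dimensional hypercube:
consecutive vertices differ in exactly one bit, and once the path has left a vertex for the next
one, it visits neither that vertex nor any other neighbour of it. -/
structure IsSnake (p : Fin (N + 1) → (Fin n → Bool)) : Prop where
  step : ∀ j k : Fin (N + 1), (j : ℕ) + 1 = k → hammingDist (p j) (p k) = 1
  avoid : ∀ j k : Fin (N + 1), (j : ℕ) + 1 < k → p j ≠ p k ∧ hammingDist (p j) (p k) ≠ 1

/-- The `n`-player binary-action game of a snake: every player receives the position of the joint
action on the path, counted from `1`, and `0` off the path. (The vertices of a snake are distinct,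
so at most one summand is not zero.) -/
def snakeGame (p : Fin (N + 1) → (Fin n → Bool)) : Fin n → (Fin n → Bool) → ℝ :=
  fun _ a => ∑ k : Fin (N + 1), if p k = a then ((k : ℕ) : ℝ) + 1 else 0

/-- The same game with its payoffs divided by the largest payoff `N + 1`. -/
noncomputable def scaledSnakeGame (p : Fin (N + 1) → (Fin n → Bool)) :
    Fin n → (Fin n → Bool) → ℝ :=
  fun i a => snakeGame p i a / ((N : ℝ) + 1)

end Snakes

end FP

namespace FP

/-! ### Colouring the edges of Hamiltonian paths in the hypercube -/

section HypercubeSnakes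

/-! At vertex k of the snake, a flip hurts every player except the one whose flip leads to vertex
k+1, so nobody else can switch. That player must stay while the old action has positive cumulative
advantage, and each iteration reduces it by only 1. Meanwhile the player due to leave k+1 gains k+1
per iteration for the current action, since flipping that bit at k leads off the snake. So k!
iterations at k store an advantage of at least (k+1)!, to be used up at k+1. By induction, under any
tie-breaking, vertex k is left only after k! iterations (`PlaysVertex.move`,
`PlaysVertex.stay_or_move`). Vertices before the last are not ε-equilibria for ε < 1, whence the
bound (N-1)!. Rescaling preserves runs and multiplies ε by N+1 < 2^n.

For snakes of length proportional to 2^n, the edges of a Hamiltonian path of a smaller cube get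
eight colours so that nearby edges differ (`exists_strong_coloring`). Eight further bits record the
colour of the current edge and keep nearby stretches apart (`exists_isSnake_of_strong_coloring`), at
the cost of a constant factor. -/

theorem hammingDist_cons {m : ℕ} (a b : Bool) (x y : Fin m → Bool) :
    hammingDist (Fin.cons a x : Fin (m + 1) → Bool) (Fin.cons b y) =
      (if a = b then 0 else 1) + hammingDist x y := by
  simp only [hammingDist, Finset.card_filter, Fin.sum_univ_succ, Fin.cons_zero, Fin.cons_succ]
  split_ifs <;> simp_all

theorem hammingDist_append {m r : ℕ} (x y : Fin m → Bool) (z w : Fin r → Bool) :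
    hammingDist (Fin.append x z) (Fin.append y w) = hammingDist x y + hammingDist z w := by
  simp only [hammingDist, Finset.card_filter, Fin.sum_univ_add, Fin.append_left, Fin.append_right]

/-- `h 0, …, h M` is a path in the hypercube, and `ψ` is a colouring of its edges which separates
consecutive edges as well as edges of equal parity with endpoints at distance at most one. -/
structure IsColoredPath {m : ℕ} (M : ℕ) (h : ℕ → Fin m → Bool) (ψ : ℕ → Fin 6) : Prop where
  parity : ∀ i j, i ≤ M → j ≤ M → hammingDist (h i) (h j) % 2 = (i + j) % 2
  inj : ∀ i j, i ≤ M → j ≤ M → h i = h j → i = j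
  step : ∀ i, i < M → hammingDist (h i) (h (i + 1)) = 1
  color_succ : ∀ i, i + 1 < M → ψ i ≠ ψ (i + 1)
  color_parity : ∀ i j a b, i < j → j < M → i % 2 = j % 2 → (a = i ∨ a = i + 1) →
    (b = j ∨ b = j + 1) → hammingDist (h a) (h b) ≤ 1 → ψ i ≠ ψ j

/-- The path in the next hypercube that runs through each vertex of `h` twice, in alternating
order of the new coordinate. -/
def doubledPath {m : ℕ} (h : ℕ → Fin m → Bool) (t : ℕ) : Fin (m + 1) → Bool :=
  Fin.cons (decide ((t / 2 + t) % 2 = 1)) (h (t / 2))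

theorem hammingDist_doubledPath {m : ℕ} (h : ℕ → Fin m → Bool) (s t : ℕ) :
    hammingDist (doubledPath h s) (doubledPath h t) =
      (if (s / 2 + s) % 2 = (t / 2 + t) % 2 then 0 else 1) +
        hammingDist (h (s / 2)) (h (t / 2)) := by
  rw [doubledPath, doubledPath, hammingDist_cons]
  congr 1
  simp only [decide_eq_decide]
  split_ifs <;> omega

namespace IsColoredPath

variable {m M : ℕ} {h : ℕ → Fin m → Bool} {ψ : ℕ → Fin 6}

/-- Odd edge 2i+1 is a copy of edge i of `h` with new coordinate fixed by the parity of i+1. If the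
parities differ, the new coordinate uses up the whole distance, so the endpoints agree in `h` and
the edges are consecutive. -/
theorem color_ne_of_odd (H : IsColoredPath M h ψ) {i j a b : ℕ} (hij : i < j) (hj : j < M)
    (ha : a = 2 * i + 1 ∨ a = 2 * i + 2) (hb : b = 2 * j + 1 ∨ b = 2 * j + 2)
    (hd : hammingDist (doubledPath h a) (doubledPath h b) ≤ 1) : ψ i ≠ ψ j := by
  rw [hammingDist_doubledPath] at hd
  by_cases hp : i % 2 = j % 2
  · exact H.color_parity i j (a / 2) (b / 2) hij hj hp (by omega) (by omega) (by omega)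
  · rw [if_neg (by omega)] at hd
    have h0 : hammingDist (h (a / 2)) (h (b / 2)) = 0 := by omega
    have := H.inj _ _ (by omega) (by omega) (hammingDist_eq_zero.1 h0)
    obtain rfl : j = i + 1 := by omega
    exact H.color_succ i hj

/-- Even edge 2i lies over the single vertex `h i`; close edges lie over adjacent vertices, and the
cube is bipartite. -/
theorem parity_ne_of_even (H : IsColoredPath M h ψ) {i j a b : ℕ} (hij : i < j) (hj : j ≤ M)
    (ha : a = 2 * i ∨ a = 2 * i + 1) (hb : b = 2 * j ∨ b = 2 * j + 1)
    (hd : hammingDist (doubledPath h a) (doubledPath h b) ≤ 1) : i % 2 ≠ j % 2 := by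
  rw [hammingDist_doubledPath, show a / 2 = i by omega, show b / 2 = j by omega] at hd
  have h0 : hammingDist (h i) (h j) ≠ 0 := fun h0 =>
    hij.ne (H.inj _ _ (by omega) hj (hammingDist_eq_zero.1 h0))
  have := H.parity i j (by omega) hj
  omega

theorem double_parity (H : IsColoredPath M h ψ) (i j : ℕ) (hi : i ≤ 2 * M + 1)
    (hj : j ≤ 2 * M + 1) :
    hammingDist (doubledPath h i) (doubledPath h j) % 2 = (i + j) % 2 := by
  have := H.parity (i / 2) (j / 2) (by omega) (by omega)
  rw [hammingDist_doubledPath]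
  split_ifs <;> omega

theorem double_inj (H : IsColoredPath M h ψ) (i j : ℕ) (hi : i ≤ 2 * M + 1)
    (hj : j ≤ 2 * M + 1) (e : doubledPath h i = doubledPath h j) : i = j := by
  have h0 := hammingDist_eq_zero.2 e
  rw [hammingDist_doubledPath] at h0
  have := H.inj (i / 2) (j / 2) (by omega) (by omega) (hammingDist_eq_zero.1 (by omega))
  split_ifs at h0 <;> omega

theorem double_step (H : IsColoredPath M h ψ) (i : ℕ) (hi : i < 2 * M + 1) :
    hammingDist (doubledPath h i) (doubledPath h (i + 1)) = 1 := by
  rw [hammingDist_doubledPath]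
  rcases Nat.even_or_odd' i with ⟨k, rfl | rfl⟩
  · rw [if_neg (by omega), show (2 * k + 1) / 2 = 2 * k / 2 by omega, hammingDist_self]
  · rw [if_pos (by omega), show (2 * k + 1) / 2 = k by omega,
      show (2 * k + 1 + 1) / 2 = k + 1 by omega, H.step k (by omega)]

theorem double (H : IsColoredPath M h ψ) :
    ∃ ψ' : ℕ → Fin 6, IsColoredPath (2 * M + 1) (doubledPath h) ψ' := by
  -- Odd edges inherit colours. Even edges use the half of the palette given by the parity of the
  -- vertex below; three colours per half leave one besides those of the two neighbouring edges.
  have hf : ∀ (b : Bool) (x y : Fin 6), ∃ z : Fin 6, z ≠ x ∧ z ≠ y ∧ (z.val < 3 ↔ b = true) := by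
    decide
  choose f hfx hfy hfb using hf
  set ψ' : ℕ → Fin 6 := fun t =>
    if t % 2 = 1 then ψ (t / 2) else f (decide (t / 2 % 2 = 0)) (ψ (t / 2 - 1)) (ψ (t / 2)) with hψ
  have hodd : ∀ i, ψ' (2 * i + 1) = ψ i := fun i => by
    simp only [hψ]
    rw [if_pos (by omega), show (2 * i + 1) / 2 = i by omega]
  -- At `i = 0` truncated subtraction merely forbids `ψ 0` twice.
  have heven : ∀ i, ψ' (2 * i) = f (decide (i % 2 = 0)) (ψ (i - 1)) (ψ i) := fun i => by
    simp only [hψ]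
    rw [if_neg (by omega), show 2 * i / 2 = i by omega]
  refine ⟨ψ', H.double_parity, H.double_inj, H.double_step, fun i hi => ?_,
    fun i j a b hij hj hp ha hb hd => ?_⟩
  · rcases Nat.even_or_odd' i with ⟨k, rfl | rfl⟩
    · rw [hodd, heven]
      exact hfy _ _ _
    · rw [hodd, show 2 * k + 1 + 1 = 2 * (k + 1) by ring, heven]
      exact (hfx _ _ _).symm
  · rcases Nat.even_or_odd' i with ⟨k, rfl | rfl⟩
    · obtain ⟨l, rfl⟩ : ∃ l, j = 2 * l := ⟨j / 2, by omega⟩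
      have hkl := H.parity_ne_of_even (by omega) (by omega) ha hb hd
      rw [heven, heven]
      intro e
      have h1 := hfb (decide (k % 2 = 0)) (ψ (k - 1)) (ψ k)
      have h2 := hfb (decide (l % 2 = 0)) (ψ (l - 1)) (ψ l)
      rw [e] at h1
      have h3 := h1.symm.trans h2
      simp only [decide_eq_true_eq] at h3
      omega
    · obtain ⟨l, rfl⟩ : ∃ l, j = 2 * l + 1 := ⟨j / 2, by omega⟩
      rw [hodd, hodd]
      exact H.color_ne_of_odd (by omega) (by omega) ha hb hd

/-- The edges of the doubled path can be coloured with eight colours such that any two edges with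
endpoints at distance at most one receive different colours. -/
theorem exists_strong_coloring (H : IsColoredPath M h ψ) :
    ∃ c : ℕ → Fin 8, ∀ i j a b, i < j → j < 2 * M + 1 → (a = i ∨ a = i + 1) →
      (b = j ∨ b = j + 1) → hammingDist (doubledPath h a) (doubledPath h b) ≤ 1 → c i ≠ c j := by
  -- Fresh colours 6 and 7 on the even edges also separate them from all odd ones.
  refine ⟨fun t => if t % 2 = 1 then (ψ (t / 2)).castLE (by omega)
    else ⟨6 + t / 2 % 2, by omega⟩, fun i j a b hij hj ha hb hd => ?_⟩
  simp only [ne_eq, Fin.ext_iff]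
  rcases Nat.even_or_odd' i with ⟨k, rfl | rfl⟩ <;> rcases Nat.even_or_odd' j with ⟨l, rfl | rfl⟩
  · have hkl := H.parity_ne_of_even (by omega) (by omega) ha hb hd
    rw [if_neg (by omega), if_neg (by omega)]
    simp only
    omega
  · rw [if_neg (by omega), if_pos (by omega)]
    have := (ψ ((2 * l + 1) / 2)).isLt
    simp only [Fin.val_castLE]
    omega
  · rw [if_pos (by omega), if_neg (by omega)]
    have := (ψ ((2 * k + 1) / 2)).isLt
    simp only [Fin.val_castLE]
    omega
  · rw [if_pos (by omega), if_pos (by omega), show (2 * l + 1) / 2 = l by omega,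
      show (2 * k + 1) / 2 = k by omega]
    have := H.color_ne_of_odd (by omega) (by omega) ha hb hd
    simpa [Fin.ext_iff] using this

end IsColoredPath

theorem exists_isColoredPath (m : ℕ) :
    ∃ (h : ℕ → Fin m → Bool) (ψ : ℕ → Fin 6), IsColoredPath (2 ^ m - 1) h ψ := by
  induction m with
  | zero =>
    refine ⟨fun _ _ => false, fun _ => 0, ?_, ?_, ?_, ?_, ?_⟩
    · intro i j hi hj
      simp at hi hj
      simp [hi, hj]
    · intro i j hi hj _
      simp at hi hj
      omega
    all_goals intros; simp at *
  | succ m ih =>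
    obtain ⟨h, ψ, H⟩ := ih
    obtain ⟨ψ', H'⟩ := H.double
    refine ⟨doubledPath h, ψ', ?_⟩
    have : 2 ^ (m + 1) - 1 = 2 * (2 ^ m - 1) + 1 := by
      have := Nat.one_le_two_pow (n := m)
      rw [pow_succ]
      omega
    rwa [this]

/-! ### From strong edge colourings to snakes -/

/-- The indicator function of `{a, b}`. -/
def pairIndicator {r : ℕ} (a b : Fin r) : Fin r → Bool :=
  fun j => decide (j = a ∨ j = b)

theorem hammingDist_pairIndicator {r : ℕ} {a b : Fin r} (hab : a ≠ b) :
    hammingDist (pairIndicator a a) (pairIndicator a b) = 1 := by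
  rw [hammingDist, Finset.card_eq_one]
  refine ⟨b, ?_⟩
  ext j
  simp only [pairIndicator, Finset.mem_filter, Finset.mem_univ, true_and, Finset.mem_singleton,
    ne_eq, decide_eq_decide]
  constructor
  · tauto
  · rintro rfl
    simp [hab.symm]

theorem pairIndicator_comm {r : ℕ} (a b : Fin r) : pairIndicator a b = pairIndicator b a := by
  funext j
  simp [pairIndicator, or_comm]

theorem one_lt_hammingDist_pairIndicator {r : ℕ} {a b : Fin r} (hab : a ≠ b) :
    1 < hammingDist (pairIndicator a a) (pairIndicator b b) := by
  rw [hammingDist, Finset.one_lt_card]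
  exact ⟨a, by simp [pairIndicator, hab], b, by simp [pairIndicator, hab.symm], hab⟩

theorem pairIndicator_ne {r : ℕ} {a b c d x : Fin r} (h : x = a ∨ x = b) (h1 : x ≠ c)
    (h2 : x ≠ d) : pairIndicator a b ≠ pairIndicator c d := by
  intro e
  have := congrFun e x
  simp only [pairIndicator, decide_eq_decide] at this
  tauto

/-- A path together with a strong edge colouring yields a snake in a larger hypercube. -/
theorem exists_isSnake_of_strong_coloring {m r M : ℕ} (h : ℕ → Fin m → Bool) (c : ℕ → Fin r)
    (inj : ∀ i j, i ≤ M → j ≤ M → h i = h j → i = j)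
    (step : ∀ i, i < M → hammingDist (h i) (h (i + 1)) = 1)
    (color : ∀ i j a b, i < j → j < M → (a = i ∨ a = i + 1) →
      (b = j ∨ b = j + 1) → hammingDist (h a) (h b) ≤ 1 → c i ≠ c j) (hM : 1 ≤ M) :
    ∃ p : Fin (3 * M - 2 + 1) → Fin (m + r) → Bool, IsSnake p := by
  have succ_ne : ∀ i, i + 1 < M → c i ≠ c (i + 1) := fun i hi =>
    color i (i + 1) (i + 1) (i + 1) (by omega) hi (by omega) (by omega) (by simp)
  -- Three steps per edge: cross edge i with label {c i}, add c (i+1), remove c i.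
  refine ⟨fun t => Fin.append (h ((t + 2) / 3)) (pairIndicator (c (t / 3)) (c ((t + 1) / 3))),
    ?_, ?_⟩
  · intro s t hst
    have ht := t.isLt
    rw [hammingDist_append, ← hst]
    generalize (s : ℕ) = s at *
    obtain ⟨i, rfl | rfl | rfl⟩ : ∃ i, s = 3 * i ∨ s = 3 * i + 1 ∨ s = 3 * i + 2 :=
      ⟨s / 3, by omega⟩
    · rw [show (3 * i + 2) / 3 = i by omega, show (3 * i + 1 + 2) / 3 = i + 1 by omega,
        show 3 * i / 3 = i by omega, show (3 * i + 1) / 3 = i by omega,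
        step i (by omega), hammingDist_self]
    · rw [show (3 * i + 1 + 2) / 3 = i + 1 by omega, show (3 * i + 1 + 1 + 2) / 3 = i + 1 by omega,
        show (3 * i + 1) / 3 = i by omega, show (3 * i + 1 + 1) / 3 = i by omega,
        hammingDist_self,
        hammingDist_pairIndicator (succ_ne i (by omega))]
    · rw [show (3 * i + 2 + 2) / 3 = i + 1 by omega, show (3 * i + 2 + 1 + 2) / 3 = i + 1 by omega,
        show (3 * i + 2) / 3 = i by omega, show (3 * i + 2 + 1) / 3 = i + 1 by omega,
        hammingDist_self, hammingDist_comm,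
        pairIndicator_comm (c i), hammingDist_pairIndicator (succ_ne i (by omega)).symm]
  · intro s t hst
    have ht := t.isLt
    suffices hd : 1 < hammingDist (h ((s + 2) / 3)) (h ((t + 2) / 3)) +
        hammingDist (pairIndicator (c (s / 3)) (c ((s + 1) / 3)))
          (pairIndicator (c (t / 3)) (c ((t + 1) / 3))) by
      rw [← hammingDist_append] at hd
      refine ⟨fun e => ?_, hd.ne'⟩
      rw [hammingDist_eq_zero.2 e] at hd
      omega
    generalize (s : ℕ) = s at *
    generalize (t : ℕ) = t at *
    rcases eq_or_ne ((s + 2) / 3) ((t + 2) / 3) with hv | hv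
    · obtain ⟨i, rfl⟩ : ∃ i, s = 3 * i + 1 := ⟨s / 3, by omega⟩
      obtain rfl : t = 3 * i + 3 := by omega
      rw [show (3 * i + 1) / 3 = i by omega, show (3 * i + 1 + 1) / 3 = i by omega,
        show (3 * i + 3) / 3 = i + 1 by omega, show (3 * i + 3 + 1) / 3 = i + 1 by omega]
      have := one_lt_hammingDist_pairIndicator (succ_ne i (by omega))
      omega
    · have hpos : hammingDist (h ((s + 2) / 3)) (h ((t + 2) / 3)) ≠ 0 := fun h0 =>
        hv (inj _ _ (by omega) (by omega) (hammingDist_eq_zero.1 h0))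
      by_contra hcon
      have hd : hammingDist (h ((s + 2) / 3)) (h ((t + 2) / 3)) ≤ 1 := by omega
      have hne : ∀ i j, i < j → j < M → ((s + 2) / 3 = i ∨ (s + 2) / 3 = i + 1) →
          ((t + 2) / 3 = j ∨ (t + 2) / 3 = j + 1) → c i ≠ c j := fun i j hij hj ha hb =>
        color i j _ _ hij hj ha hb hd
      refine absurd (hammingDist_eq_zero.1 (by omega : hammingDist
        (pairIndicator (c (s / 3)) (c ((s + 1) / 3)))
        (pairIndicator (c (t / 3)) (c ((t + 1) / 3))) = 0)) ?_
      -- The labels differ: either the first colour of `s` is absent at `t`, or s = 3i, t = 3i+2 and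
      -- c (i+1) is absent at `s`.
      by_cases hs : s / 3 < t / 3
      · exact pairIndicator_ne (Or.inl rfl) (hne _ _ (by omega) (by omega) (by omega) (by omega))
          (hne _ _ (by omega) (by omega) (by omega) (by omega))
      · exact (pairIndicator_ne (x := c ((t + 1) / 3)) (Or.inr rfl)
          (hne _ _ (by omega) (by omega) (by omega) (by omega)).symm
          (hne _ _ (by omega) (by omega) (by omega) (by omega)).symm).symm

theorem exists_isSnake_add_nine (m : ℕ) :
    ∃ p : Fin (3 * 2 ^ (m + 1) - 5 + 1) → Fin (m + 9) → Bool, IsSnake p := by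
  obtain ⟨h, ψ, H⟩ := exists_isColoredPath m
  obtain ⟨c, hc⟩ := H.exists_strong_coloring
  have key := exists_isSnake_of_strong_coloring (doubledPath h) c H.double_inj H.double_step
    hc (by omega)
  have : 3 * (2 * (2 ^ m - 1) + 1) - 2 = 3 * 2 ^ (m + 1) - 5 := by
    have := Nat.one_le_two_pow (n := m)
    rw [pow_succ]
    omega
  rwa [this] at key

theorem exists_isSnake_one {n : ℕ} (hn : 1 ≤ n) :
    ∃ p : Fin (1 + 1) → Fin n → Bool, IsSnake p := by
  refine ⟨![fun _ => false, Function.update (fun _ => false) ⟨0, hn⟩ true], ?_, ?_⟩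
  · intro j k hjk
    obtain rfl : j = 0 := by ext; simp; omega
    obtain rfl : k = 1 := by ext; simp at hjk ⊢; omega
    rw [hammingDist, Finset.card_eq_one]
    refine ⟨⟨0, hn⟩, ?_⟩
    ext i
    by_cases hi : i = ⟨0, hn⟩ <;> simp [hi, Function.update_apply]
  · intro j k hjk
    omega

end HypercubeSnakes

/-! ### Binary games at pure profiles and cumulative advantages -/

section PureProfiles

variable {ι : Type*} [DecidableEq ι]

theorem update_pureProfile (a : ι → Bool) (i : ι) (b : Bool) :
    Function.update (pureProfile a) i (Pi.single b 1) = pureProfile (Function.update a i b) := by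
  funext j
  rcases eq_or_ne j i with rfl | hj
  · simp [pureProfile]
  · simp [pureProfile, hj]

/-- The vertex obtained from `a` by flipping bit `i`. -/
def flipAt (i : ι) (a : ι → Bool) : ι → Bool :=
  Function.update a i (!a i)

theorem flipAt_flipAt (i : ι) (a : ι → Bool) : flipAt i (flipAt i a) = a := by
  simp [flipAt]

theorem flipAt_injective_left (a : ι → Bool) : Function.Injective fun i => flipAt i a := by
  intro i j h
  by_contra hij
  have := congrFun h i
  simp [flipAt, hij] at this

variable [Fintype ι]

theorem expectedUtility_pureProfile (f : (ι → Bool) → ℝ) (a : ι → Bool) :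
    expectedUtility f (pureProfile a) = f a := by
  rw [expectedUtility, Finset.sum_eq_single a]
  · simp [pureProfile]
  · intro b _ hb
    obtain ⟨i, hi⟩ := Function.ne_iff.1 hb
    rw [Finset.prod_eq_zero (Finset.mem_univ i), zero_mul]
    simp [pureProfile, hi]
  · simp

theorem utilityVector_pureProfile (u : ι → (ι → Bool) → ℝ) (i : ι) (a : ι → Bool) (b : Bool) :
    utilityVector u i (pureProfile a) b = u i (Function.update a i b) := by
  rw [utilityVector, update_pureProfile, expectedUtility_pureProfile]

theorem hammingDist_flipAt_flipAt (i : ι) (a b : ι → Bool) :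
    hammingDist (flipAt i a) (flipAt i b) = hammingDist a b := by
  rw [hammingDist, hammingDist]
  congr 1
  ext j
  simp only [Finset.mem_filter, Finset.mem_univ, true_and]
  rcases eq_or_ne j i with rfl | hj
  · simp [flipAt]
  · simp [flipAt, hj]

theorem hammingDist_flipAt (i : ι) (a : ι → Bool) : hammingDist a (flipAt i a) = 1 := by
  rw [hammingDist, Finset.card_eq_one]
  refine ⟨i, ?_⟩
  ext j
  simp only [Finset.mem_filter, Finset.mem_univ, true_and, Finset.mem_singleton]
  rcases eq_or_ne j i with rfl | hj
  · simp [flipAt]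
  · simp [flipAt, hj]

theorem exists_eq_flipAt {a b : ι → Bool} (h : hammingDist a b = 1) : ∃ i, b = flipAt i a := by
  rw [hammingDist, Finset.card_eq_one] at h
  obtain ⟨i, hi⟩ := h
  refine ⟨i, ?_⟩
  funext j
  have := Finset.ext_iff.1 hi j
  simp only [Finset.mem_filter, Finset.mem_univ, true_and, Finset.mem_singleton] at this
  rcases eq_or_ne j i with rfl | hj
  · simp only [iff_true] at this
    simpa [flipAt] using (Bool.eq_not.2 (Ne.symm this))
  · simp only [hj, iff_false, not_not] at this
    simp [flipAt, hj, this]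

/-- The advantage of action `b` over the other action of player `i` in the first `t` iterations. -/
noncomputable def advantage (u : ι → (ι → Bool) → ℝ) (x : ℕ → ι → Bool → ℝ) (i : ι) (b : Bool)
    (t : ℕ) : ℝ :=
  cumulativeUtility u x i t b - cumulativeUtility u x i t (!b)

theorem advantage_zero (u : ι → (ι → Bool) → ℝ) (x : ℕ → ι → Bool → ℝ) (i : ι) (b : Bool) :
    advantage u x i b 0 = 0 := by
  simp [advantage, cumulativeUtility]

theorem advantage_not (u : ι → (ι → Bool) → ℝ) (x : ℕ → ι → Bool → ℝ) (i : ι) (b : Bool)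
    (t : ℕ) : advantage u x i (!b) t = -advantage u x i b t := by
  simp [advantage]

theorem advantage_succ (u : ι → (ι → Bool) → ℝ) {x : ℕ → ι → Bool → ℝ} {t : ℕ} {a : ι → Bool}
    (hx : x (t + 1) = pureProfile a) (i : ι) :
    advantage u x i (a i) (t + 1) = advantage u x i (a i) t + (u i a - u i (flipAt i a)) := by
  simp only [advantage, cumulativeUtility]
  rw [Finset.sum_Icc_succ_top (by omega), hx]
  simp only [Pi.add_apply, utilityVector_pureProfile, flipAt, Function.update_eq_self]
  ring

theorem IsFictitiousPlay.advantage_nonneg {u : ι → (ι → Bool) → ℝ} {x : ℕ → ι → Bool → ℝ}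
    (H : IsFictitiousPlay u x) {t : ℕ} (ht : 1 ≤ t) {i : ι} {b : Bool}
    (hb : x (t + 1) i = Pi.single b 1) : 0 ≤ advantage u x i b t := by
  have := H.argmax t ht i (Pi.single (!b) 1) (single_mem_stdSimplex ℝ _)
  rw [hb, single_one_dotProduct, single_one_dotProduct] at this
  exact sub_nonneg.2 this

theorem IsFictitiousPlay.eq_single_of_advantage_pos {u : ι → (ι → Bool) → ℝ}
    {x : ℕ → ι → Bool → ℝ} (H : IsFictitiousPlay u x) {t : ℕ} (ht : 1 ≤ t) {i : ι} {b : Bool}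
    (hb : 0 < advantage u x i b t) : x (t + 1) i = Pi.single b 1 := by
  obtain ⟨c, hc⟩ := H.pure_succ t ht i
  have h0 := H.advantage_nonneg ht hc
  rcases eq_or_ne c b with rfl | hcb
  · exact hc
  · rw [Bool.eq_not.2 hcb, advantage_not] at h0
    linarith

end PureProfiles

/-! ### Payoffs along a snake -/

section SnakeGames

variable {n N : ℕ} {p : Fin (N + 1) → Fin n → Bool}

/-- The snake `p` as a sequence indexed by the natural numbers, constant from `N` on. -/
def vertex (p : Fin (N + 1) → Fin n → Bool) (k : ℕ) : Fin n → Bool :=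
  p ⟨min k N, by omega⟩

theorem vertex_val (p : Fin (N + 1) → Fin n → Bool) (k : Fin (N + 1)) : vertex p k = p k := by
  simp only [vertex]
  congr
  omega

namespace IsSnake

theorem vertex_step (hp : IsSnake p) {k : ℕ} (hk : k < N) :
    hammingDist (vertex p k) (vertex p (k + 1)) = 1 :=
  hp.step _ _ (by simp only; omega)

theorem vertex_avoid (hp : IsSnake p) {j k : ℕ} (hjk : j + 1 < k) (hk : k ≤ N) :
    vertex p j ≠ vertex p k ∧ hammingDist (vertex p j) (vertex p k) ≠ 1 :=
  hp.avoid _ _ (by simp only; omega)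

theorem vertex_lt_ne (hp : IsSnake p) {j k : ℕ} (hjk : j < k) (hk : k ≤ N) :
    vertex p j ≠ vertex p k := by
  rcases (Nat.succ_le_of_lt hjk).eq_or_lt with rfl | h
  · intro e
    have := hp.vertex_step (k := j) (by omega)
    rw [← Nat.succ_eq_add_one, ← e, hammingDist_self] at this
    omega
  · exact (hp.vertex_avoid h hk).1

theorem vertex_inj (hp : IsSnake p) {j k : ℕ} (hj : j ≤ N) (hk : k ≤ N)
    (e : vertex p j = vertex p k) : j = k := by
  rcases lt_trichotomy j k with h | h | h
  · exact absurd e (hp.vertex_lt_ne h hk)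
  · exact h
  · exact absurd e.symm (hp.vertex_lt_ne h hj)

theorem vertex_adj (hp : IsSnake p) {j k : ℕ} (hj : j ≤ N) (hk : k ≤ N)
    (e : hammingDist (vertex p j) (vertex p k) = 1) : j = k + 1 ∨ k = j + 1 := by
  rcases lt_trichotomy j k with h | h | h
  · by_contra hc
    exact (hp.vertex_avoid (by omega) hk).2 e
  · rw [h, hammingDist_self] at e
    omega
  · by_contra hc
    rw [hammingDist_comm] at e
    exact (hp.vertex_avoid (by omega) hj).2 e

theorem injective (hp : IsSnake p) : Function.Injective p := by
  intro j k e
  rw [← vertex_val p j, ← vertex_val p k] at e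
  exact Fin.ext (hp.vertex_inj (by omega) (by omega) e)

theorem snakeGame_vertex (hp : IsSnake p) (i : Fin n) {k : ℕ} (hk : k ≤ N) :
    snakeGame p i (vertex p k) = k + 1 := by
  rw [snakeGame, Finset.sum_eq_single ⟨k, by omega⟩]
  · rw [if_pos (vertex_val p ⟨k, by omega⟩).symm]
  · intro j _ hj
    refine if_neg fun e => hj (hp.injective ?_)
    rw [e, ← vertex_val p]
  · simp

theorem snakeGame_eq_zero {a : Fin n → Bool} (ha : ∀ k, k ≤ N → vertex p k ≠ a) (i : Fin n) :
    snakeGame p i a = 0 := by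
  refine Finset.sum_eq_zero fun k _ => if_neg fun e => ha k (by omega) ?_
  rw [vertex_val, e]

theorem gain_next (hp : IsSnake p) {k : ℕ} (hk : k < N) {i : Fin n}
    (hi : vertex p (k + 1) = flipAt i (vertex p k)) :
    snakeGame p i (vertex p k) - snakeGame p i (flipAt i (vertex p k)) = -1 := by
  rw [← hi, hp.snakeGame_vertex i hk.le, hp.snakeGame_vertex i hk]
  push_cast
  ring

/-- Any such flip leads back to vertex k-1 or off the snake. -/
theorem one_le_gain (hp : IsSnake p) {k : ℕ} (hk : k ≤ N) {i : Fin n}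
    (hi : vertex p (k + 1) ≠ flipAt i (vertex p k)) :
    1 ≤ snakeGame p i (vertex p k) - snakeGame p i (flipAt i (vertex p k)) := by
  rw [hp.snakeGame_vertex i hk]
  by_cases h : ∃ j, j ≤ N ∧ vertex p j = flipAt i (vertex p k)
  · obtain ⟨j, hj, e⟩ := h
    have hd := hammingDist_flipAt i (vertex p k)
    rw [← e] at hd ⊢
    rcases hp.vertex_adj hk hj hd with rfl | rfl
    · rw [hp.snakeGame_vertex i hj]
      push_cast
      linarith
    · exact absurd e hi
  · push Not at h
    rw [snakeGame_eq_zero h]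
    have : (0 : ℝ) ≤ k := k.cast_nonneg
    linarith

/-- The flipped vertex is adjacent to vertices k and k+2. On the snake it could only be vertex k+1,
which would make vertices k and k+2 equal. -/
theorem gain_second_next (hp : IsSnake p) {k : ℕ} (hk : k + 2 ≤ N) {i : Fin n}
    (hi : vertex p (k + 2) = flipAt i (vertex p (k + 1))) :
    snakeGame p i (vertex p k) - snakeGame p i (flipAt i (vertex p k)) = k + 1 := by
  rw [hp.snakeGame_vertex i (by omega), snakeGame_eq_zero, sub_zero]
  intro j hj e
  have h1 : hammingDist (vertex p k) (vertex p j) = 1 := by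
    rw [e, hammingDist_flipAt]
  have h2 : hammingDist (vertex p j) (vertex p (k + 2)) = 1 := by
    rw [e, hi, hammingDist_flipAt_flipAt, hp.vertex_step (by omega)]
  have h3 := hp.vertex_adj (by omega) hj h1
  have h4 := hp.vertex_adj hj hk h2
  obtain rfl : j = k + 1 := by omega
  rw [e, flipAt_flipAt] at hi
  exact hp.vertex_lt_ne (by omega) hk hi.symm

theorem apply_eq_of_second_next (hp : IsSnake p) {k : ℕ} (hk : k + 2 ≤ N) {i : Fin n}
    (hi : vertex p (k + 2) = flipAt i (vertex p (k + 1))) :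
    vertex p (k + 1) i = vertex p k i := by
  obtain ⟨i₀, h0⟩ := exists_eq_flipAt (hp.vertex_step (k := k) (by omega))
  have : i ≠ i₀ := by
    rintro rfl
    rw [h0, flipAt_flipAt] at hi
    exact hp.vertex_lt_ne (by omega) hk hi.symm
  rw [h0]
  simp [flipAt, this]

/-- A snake through all vertices would contain every neighbour of its start, but only vertex 1 may
be one. -/
theorem card_lt (hp : IsSnake p) (hn : 2 ≤ n) : N + 1 < 2 ^ n := by
  suffices h : ∃ b, b ∉ Set.range p by
    obtain ⟨b, hb⟩ := h
    simpa using Fintype.card_lt_of_injective_of_notMem p hp.injective hb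
  by_contra! h
  have key : ∀ i : Fin n, flipAt i (vertex p 0) = vertex p 1 := by
    intro i
    obtain ⟨j, hj⟩ := h (flipAt i (vertex p 0))
    have hd := hammingDist_flipAt i (vertex p 0)
    rw [← hj, ← vertex_val p] at hd ⊢
    rcases hp.vertex_adj (by omega) (by omega) hd with h1 | h1
    · omega
    · rw [h1]
  have := flipAt_injective_left (vertex p 0) ((key ⟨0, by omega⟩).trans (key ⟨1, by omega⟩).symm)
  simp at this

end IsSnake

/-! ### The invariant of fictitious play -/

/-- In iteration `t + 1`, vertex `k` of the snake is played for the `j`-th time; the advantages of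
the current actions of the players who leave the vertices `k` and `k + 1` are large. -/
structure PlaysVertex (p : Fin (N + 1) → Fin n → Bool) (x : ℕ → Fin n → Bool → ℝ)
    (t k j : ℕ) : Prop where
  lt : k < N
  eq : x (t + 1) = pureProfile (vertex p k)
  one_le : 1 ≤ j
  le : j ≤ t + 1
  nonneg : ∀ i, 0 ≤ advantage (snakeGame p) x i (vertex p k i) t
  next : k = 0 ∨ ∀ i, vertex p (k + 1) = flipAt i (vertex p k) →
    (k.factorial : ℝ) - j ≤ advantage (snakeGame p) x i (vertex p k i) (t + 1)
  second_next : k + 2 ≤ N → ∀ i, vertex p (k + 2) = flipAt i (vertex p (k + 1)) →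
    ((k : ℝ) + 1) * j ≤ advantage (snakeGame p) x i (vertex p k i) (t + 1)

namespace PlaysVertex

variable {x : ℕ → Fin n → Bool → ℝ} {t k j : ℕ}

theorem stay (H : PlaysVertex p x t k j) (hp : IsSnake p)
    (hx : IsFictitiousPlay (snakeGame p) x) (h : x (t + 2) = pureProfile (vertex p k)) :
    PlaysVertex p x (t + 1) k (j + 1) where
  lt := H.lt
  eq := h
  one_le := by omega
  le := by have := H.le; omega
  nonneg i := hx.advantage_nonneg (by omega) (by rw [h, pureProfile])
  next := by
    refine H.next.imp_right fun hk i hi => ?_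
    rw [advantage_succ _ h, hp.gain_next H.lt hi]
    have := hk i hi
    push_cast
    linarith
  second_next hk i hi := by
    rw [advantage_succ _ h, hp.gain_second_next hk hi]
    have := H.second_next hk i hi
    push_cast
    linarith

theorem move (H : PlaysVertex p x t k j) (hp : IsSnake p)
    (hx : IsFictitiousPlay (snakeGame p) x) (h : x (t + 2) = pureProfile (vertex p (k + 1)))
    (hk : k + 1 < N) (hj : k.factorial ≤ j) : PlaysVertex p x (t + 1) (k + 1) 1 := by
  have hnn : ∀ i, 0 ≤ advantage (snakeGame p) x i (vertex p (k + 1) i) (t + 1) := fun i =>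
    hx.advantage_nonneg (by omega) (by rw [h, pureProfile])
  refine ⟨hk, h, le_rfl, by omega, hnn, Or.inr fun i hi => ?_, fun hk2 i hi => ?_⟩
  · have h1 := H.second_next hk i hi
    rw [← hp.apply_eq_of_second_next hk hi] at h1
    rw [advantage_succ _ h, hp.gain_next hk hi]
    -- The factorial recursion: k! plays worth k+1 each.
    have h2 : ((k : ℝ) + 1) * k.factorial ≤ ((k : ℝ) + 1) * j := by gcongr
    rw [Nat.factorial_succ]
    push_cast
    linarith
  · rw [advantage_succ _ h, hp.gain_second_next hk2 hi]
    have := hnn i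
    push_cast
    linarith

theorem stay_or_move (H : PlaysVertex p x t k j) (hp : IsSnake p)
    (hx : IsFictitiousPlay (snakeGame p) x) :
    x (t + 2) = pureProfile (vertex p k) ∨
      x (t + 2) = pureProfile (vertex p (k + 1)) ∧ k.factorial ≤ j := by
  obtain ⟨i₀, h0⟩ := exists_eq_flipAt (hp.vertex_step H.lt)
  have other : ∀ i, i ≠ i₀ → x (t + 2) i = Pi.single (vertex p k i) 1 := by
    intro i hi
    refine hx.eq_single_of_advantage_pos (by omega) ?_
    have h1 := hp.one_le_gain H.lt.le (i := i)
      fun e => hi (flipAt_injective_left _ (e.symm.trans h0))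
    rw [advantage_succ _ H.eq]
    have := H.nonneg i
    linarith
  obtain ⟨b, hb⟩ := hx.pure_succ (t + 1) (by omega) i₀
  rcases eq_or_ne b (vertex p k i₀) with rfl | hne
  · left
    funext i
    rcases eq_or_ne i i₀ with rfl | hi
    · exact hb
    · exact other i hi
  · have hb' := Bool.eq_not.2 hne
    refine Or.inr ⟨?_, ?_⟩
    · funext i
      rw [h0, pureProfile, flipAt]
      rcases eq_or_ne i i₀ with rfl | hi
      · rw [Function.update_self, ← hb', ← hb]
      · rw [Function.update_of_ne hi, other i hi]
    -- Vertex 0 starts with no stored advantage, but 0! = 1 play has already happened.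
    · rcases H.next with rfl | hk
      · simpa using H.one_le
      · have h1 := hk i₀ h0
        have h2 := hx.advantage_nonneg (by omega) hb
        rw [hb', advantage_not] at h2
        exact_mod_cast (by linarith : (k.factorial : ℝ) ≤ j)

theorem not_isEpsNash (H : PlaysVertex p x t k j) (hp : IsSnake p) {ε : ℝ} (hε : ε < 1) :
    ¬ IsEpsNash (snakeGame p) ε (x (t + 1)) := by
  obtain ⟨i₀, h0⟩ := exists_eq_flipAt (hp.vertex_step H.lt)
  rintro ⟨-, h⟩
  have h1 := h i₀ (Pi.single (!vertex p k i₀) 1) (single_mem_stdSimplex ℝ _)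
  rw [H.eq, update_pureProfile, expectedUtility_pureProfile, expectedUtility_pureProfile] at h1
  have h2 := hp.gain_next H.lt h0
  rw [flipAt] at h2
  linarith

end PlaysVertex

namespace IsSnake

variable {x : ℕ → Fin n → Bool → ℝ}

theorem playsVertex_zero (hp : IsSnake p) (hN : 1 ≤ N) (h1 : x 1 = pureProfile (p 0)) :
    PlaysVertex p x 0 0 1 := by
  have h1' : x (0 + 1) = pureProfile (vertex p 0) := by
    rw [zero_add, h1, ← vertex_val p]
    rfl
  refine ⟨hN, h1', le_rfl, by omega, fun i => (advantage_zero _ _ _ _).ge, Or.inl rfl,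
    fun hk i hi => ?_⟩
  rw [advantage_succ _ h1', hp.gain_second_next hk hi, advantage_zero]
  simp

theorem playsVertex_or_factorial_lt (hp : IsSnake p) (hN : 1 ≤ N)
    (hx : IsFictitiousPlay (snakeGame p) x) (h1 : x 1 = pureProfile (p 0)) (t : ℕ) :
    (∃ k j, PlaysVertex p x t k j) ∨ (N - 1).factorial < t + 1 := by
  induction t with
  | zero => exact Or.inl ⟨0, 1, hp.playsVertex_zero hN h1⟩
  | succ t ih =>
    rcases ih with ⟨k, j, H⟩ | h
    · rcases H.stay_or_move hp hx with h | ⟨h, hj⟩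
      · exact Or.inl ⟨k, j + 1, H.stay hp hx h⟩
      · rcases (Nat.succ_le_of_lt H.lt).eq_or_lt with rfl | hk
        · have := H.le
          refine Or.inr ?_
          simp only [Nat.succ_eq_add_one, Nat.add_sub_cancel]
          omega
        · exact Or.inl ⟨k + 1, 1, H.move hp hx h hk hj⟩
    · exact Or.inr (by omega)

theorem factorial_lt_of_isEpsNash (hp : IsSnake p) (hN : 1 ≤ N)
    (hx : IsFictitiousPlay (snakeGame p) x) (h1 : x 1 = pureProfile (p 0)) {ε : ℝ} (hε : ε < 1)
    {t : ℕ} (ht : 1 ≤ t) (hnash : IsEpsNash (snakeGame p) ε (x t)) :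
    (N - 1).factorial < t := by
  obtain ⟨s, rfl⟩ := Nat.exists_eq_add_of_le' ht
  rcases hp.playsVertex_or_factorial_lt hN hx h1 s with ⟨k, j, H⟩ | h
  · exact absurd hnash (H.not_isEpsNash hp hε)
  · exact h

end IsSnake

/-! ### Potentials and rescaling -/

theorem isPotentialGame_of_eq {u : Fin n → (Fin n → Bool) → ℝ} {f : (Fin n → Bool) → ℝ}
    (h : ∀ i, u i = f) : IsPotentialGame u :=
  ⟨expectedUtility f, fun x _ i y _ y' _ => by rw [h i]⟩

theorem expectedUtility_scaledSnakeGame (p : Fin (N + 1) → Fin n → Bool) (i : Fin n)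
    (x : Fin n → Bool → ℝ) :
    expectedUtility (scaledSnakeGame p i) x =
      ((N : ℝ) + 1)⁻¹ * expectedUtility (snakeGame p i) x := by
  rw [expectedUtility, expectedUtility, Finset.mul_sum]
  refine Finset.sum_congr rfl fun a _ => ?_
  rw [scaledSnakeGame]
  ring

theorem cumulativeUtility_scaledSnakeGame (p : Fin (N + 1) → Fin n → Bool)
    (x : ℕ → Fin n → Bool → ℝ) (i : Fin n) (t : ℕ) :
    cumulativeUtility (scaledSnakeGame p) x i t =
      ((N : ℝ) + 1)⁻¹ • cumulativeUtility (snakeGame p) x i t := by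
  rw [cumulativeUtility, cumulativeUtility, Finset.smul_sum]
  refine Finset.sum_congr rfl fun τ _ => ?_
  funext b
  exact expectedUtility_scaledSnakeGame p i _

theorem IsFictitiousPlay.of_scaledSnakeGame {x : ℕ → Fin n → Bool → ℝ}
    (hx : IsFictitiousPlay (scaledSnakeGame p) x) : IsFictitiousPlay (snakeGame p) x where
  mixed_one := hx.mixed_one
  pure_succ := hx.pure_succ
  argmax t ht i y hy := by
    have := hx.argmax t ht i y hy
    rw [cumulativeUtility_scaledSnakeGame, dotProduct_smul, dotProduct_smul, smul_eq_mul,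
      smul_eq_mul] at this
    exact le_of_mul_le_mul_left this (by positivity)

theorem IsEpsNash.of_scaledSnakeGame {x : Fin n → Bool → ℝ} {ε : ℝ}
    (hx : IsEpsNash (scaledSnakeGame p) ε x) :
    IsEpsNash (snakeGame p) (((N : ℝ) + 1) * ε) x := by
  refine ⟨hx.1, fun i y hy => ?_⟩
  have h := hx.2 i y hy
  rw [expectedUtility_scaledSnakeGame, expectedUtility_scaledSnakeGame] at h
  have hN : (0 : ℝ) < (N : ℝ) + 1 := by positivity
  have h2 := mul_le_mul_of_nonneg_left h hN.le
  rwa [mul_add, mul_inv_cancel_left₀ hN.ne', mul_inv_cancel_left₀ hN.ne'] at h2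

theorem IsSnake.scaledSnakeGame_mem_Icc (hp : IsSnake p) (i : Fin n) (a : Fin n → Bool) :
    scaledSnakeGame p i a ∈ Set.Icc (0 : ℝ) 1 := by
  rw [scaledSnakeGame]
  by_cases h : ∃ k, k ≤ N ∧ vertex p k = a
  · obtain ⟨k, hk, rfl⟩ := h
    rw [hp.snakeGame_vertex i hk]
    refine ⟨by positivity, (div_le_one (by positivity)).2 ?_⟩
    gcongr
  · push Not at h
    rw [IsSnake.snakeGame_eq_zero h]
    simp

end SnakeGames

/-! ### Constants -/

theorem two_pow_le_factorial_succ (k : ℕ) : 2 ^ k ≤ (k + 1).factorial := by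
  induction k with
  | zero => simp
  | succ k ih =>
    rw [pow_succ, Nat.factorial_succ (k + 1), mul_comm]
    exact Nat.mul_le_mul (by omega) ih

/-- Every hypercube contains a snake whose length is a constant fraction of its order. -/
theorem exists_long_isSnake {n : ℕ} (hn : 1 ≤ n) :
    ∃ (N : ℕ) (p : Fin (N + 1) → Fin n → Bool), IsSnake p ∧ 1 ≤ N ∧
      (1 / 1024 : ℝ) * 2 ^ n ≤ N ∧
      Nat.factorial ⌊(1 / 1024 : ℝ) * 2 ^ n⌋₊ ≤ (N - 1).factorial + 1 ∧
      (2 : ℝ) ^ ((1 / 1024 : ℝ) * 2 ^ n) ≤ (N - 1).factorial + 1 := by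
  -- With C = 2^(-10), C * 2^n < 1 for n ≤ 9, so one edge suffices. There the summand 1, from the
  -- strict bound (N-1)! < t, is needed for the power of two.
  rcases le_or_gt n 9 with h9 | h9
  · obtain ⟨p, hp⟩ := exists_isSnake_one hn
    have hlt : (1 / 1024 : ℝ) * 2 ^ n < 1 := by
      have : (2 : ℝ) ^ n ≤ 2 ^ 9 := pow_le_pow_right₀ (by norm_num) h9
      norm_num at this ⊢
      linarith
    refine ⟨1, p, hp, le_rfl, by simpa using hlt.le, ?_, ?_⟩
    · rw [Nat.floor_eq_zero.2 hlt]
      simp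
    · calc (2 : ℝ) ^ ((1 / 1024 : ℝ) * 2 ^ n) ≤ 2 ^ (1 : ℝ) :=
            Real.rpow_le_rpow_of_exponent_le (by norm_num) hlt.le
        _ = _ := by norm_num
  · obtain ⟨m, rfl⟩ : ∃ m, n = m + 1 + 9 := ⟨n - 10, by omega⟩
    obtain ⟨p, hp⟩ := exists_isSnake_add_nine (m + 1)
    have hX := Nat.one_le_two_pow (n := m)
    have hpow : 2 ^ (m + 1 + 1) = 4 * 2 ^ m := by ring
    have hC : (1 / 1024 : ℝ) * 2 ^ (m + 1 + 9) = ((2 ^ m : ℕ) : ℝ) := by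
      push_cast
      ring
    refine ⟨_, p, hp, by omega, ?_, ?_, ?_⟩
    · rw [hC]
      exact_mod_cast (by omega)
    · rw [hC, Nat.floor_natCast]
      exact (Nat.factorial_le (by omega)).trans (Nat.le_succ _)
    · rw [hC, Real.rpow_natCast]
      have := (two_pow_le_factorial_succ (2 ^ m)).trans
        (Nat.factorial_le (by omega : 2 ^ m + 1 ≤ 3 * 2 ^ (m + 1 + 1) - 5 - 1))
      exact_mod_cast this.trans (Nat.le_succ _)

end FP

theorem mainTheorem3 :
    ∃ C : ℝ, 0 < C ∧ ∀ n : ℕ, 1 ≤ n →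
      ∃ (N : ℕ) (p : Fin (N + 1) → (Fin n → Bool)),
        FP.IsSnake p ∧ C * 2 ^ n ≤ (N : ℝ) ∧
        FP.IsIdenticalInterest (FP.snakeGame p) ∧
        FP.IsPotentialGame (FP.snakeGame p) ∧
        (∀ x : ℕ → Fin n → Bool → ℝ,
          FP.IsFictitiousPlay (FP.snakeGame p) x → x 1 = FP.pureProfile (p 0) →
          ∀ ε : ℝ, 0 ≤ ε → ε < 1 → ∀ t : ℕ, 1 ≤ t →
            FP.IsEpsNash (FP.snakeGame p) ε (x t) →
            Nat.factorial ⌊C * 2 ^ n⌋₊ ≤ t) ∧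
        (2 ≤ n →
          (∀ i a, FP.scaledSnakeGame p i a ∈ Set.Icc (0 : ℝ) 1) ∧
          FP.IsIdenticalInterest (FP.scaledSnakeGame p) ∧
          FP.IsPotentialGame (FP.scaledSnakeGame p) ∧
          ∀ x : ℕ → Fin n → Bool → ℝ,
            FP.IsFictitiousPlay (FP.scaledSnakeGame p) x → x 1 = FP.pureProfile (p 0) →
            ∀ ε : ℝ, 0 ≤ ε → ε ≤ 1 / 2 ^ n → ∀ t : ℕ, 1 ≤ t →
              FP.IsEpsNash (FP.scaledSnakeGame p) ε (x t) →
              (2 : ℝ) ^ (C * 2 ^ n) ≤ (t : ℝ)) := by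
  refine ⟨1 / 1024, by norm_num, fun n hn => ?_⟩
  obtain ⟨N, p, hp, hN, hlen, hfac, hexp⟩ := FP.exists_long_isSnake hn
  refine ⟨N, p, hp, hlen, fun _ _ => rfl,
    FP.isPotentialGame_of_eq (f := FP.snakeGame p ⟨0, hn⟩) fun _ => rfl,
    fun x hx h1 ε _ hε t ht hnash =>
      hfac.trans (hp.factorial_lt_of_isEpsNash hN hx h1 hε ht hnash), fun hn2 =>
    ⟨hp.scaledSnakeGame_mem_Icc, fun _ _ => rfl,
      FP.isPotentialGame_of_eq (f := FP.scaledSnakeGame p ⟨0, hn⟩) fun _ => rfl,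
      fun x hx h1 ε _ hε t ht hnash => ?_⟩⟩
  have hε1 : ((N : ℝ) + 1) * ε < 1 := by
    have hcard : ((N : ℝ) + 1) < 2 ^ n := by exact_mod_cast hp.card_lt hn2
    calc ((N : ℝ) + 1) * ε ≤ ((N : ℝ) + 1) * (1 / 2 ^ n) := by gcongr
      _ < 1 := by rwa [mul_one_div, div_lt_one (by positivity)]
  have := hp.factorial_lt_of_isEpsNash hN hx.of_scaledSnakeGame h1 hε1 ht hnash.of_scaledSnakeGame
  exact hexp.trans (by exact_mod_cast this)
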